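/- **Theorem 1.4.** Let $(\Omega,\leq)$ be a countable totally ordered set, and assume that the group $\operatorname{Aut}(\Omega,\leq)$ of order-automorphisms of $\Omega$ (order-preserving bijections $\Omega\to\Omega$ with order-preserving inverse, under composition) is countable. Then $\operatorname{Aut}(\Omega,\leq)$ is a free abelian group of finite rank; that is, there is an integer $n\geq 0$ such that $\operatorname{Aut}(\Omega,\leq)\cong\mathbb{Z}^n$. -/

import Mathlib

/-!
# Countable automorphism groups of countable linear orders

Write `G` for the automorphism group of a countable linear order, and suppose it is countable.
With the topology of pointwise convergence `G` is a countable completely metrizable group, so by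
Baire it is discrete: some finite set `F` has trivial pointwise stabilizer
(`exists_finset_stabilizer_eq_one`).

The convex hulls of the orbits of `G` partition the order into convex invariant classes, and
automorphisms of the classes can be glued freely. So `G` is the product of the automorphism groups
of the classes (`hullEquivPi`), and only the finitely many classes that meet `F` can have a
nontrivial one (`finite_nontrivial_hull`). It remains to see that the automorphism group of a single
class is trivial or infinite cyclic.

In a class every orbit is cofinal and coinitial. If an automorphism fixes a point `x`, its part above
`x` can be conjugated so that its support lies above the finite set with trivial stabilizer, hence is
trivial, and likewise for the part below `x`. So the action is free (`eq_one_of_apply_eq`). Cutting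
and pasting then shows that every nontrivial automorphism moves all points up or all points down
(`pos_of_lt`), and that the group is Archimedean (`Pos.exists_lt_pow`). If there is a least positive
automorphism, it generates the group (`exists_zpow_eq`). Otherwise the group is densely ordered, and
every orbit is dense for the relation `Far` (`Far.exists_between`). As in Skolem's theorem on
countable dense orders with dense colour classes, the orbits being the colours, a back-and-forth
argument then produces a nontrivial automorphism with a fixed point, which contradicts freeness
(`not_pos_of_dense`).
-/

namespace OrderAut

variable {α : Type*} [LinearOrder α]

/-! ### A finite set with trivial stabilizer -/

/-- The automorphisms form a closed subset of `(α → α) × (α → α)` (an automorphism and its inverse,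
`α` being discrete), so they form a Baire space. A countable Baire space has an isolated point,
and a basic neighbourhood of that point is described by finitely many values. -/
theorem exists_finset_stabilizer_eq_one [Countable α] [Countable (α ≃o α)] :
    ∃ F : Finset α, ∀ g : α ≃o α, (∀ x ∈ F, g x = x) → g = 1 := by
  classical
  let τ : TopologicalSpace α := ⊥
  have : DiscreteTopology α := ⟨rfl⟩
  let X : Set ((α → α) × (α → α)) :=
    {p | (∀ x y, x < y → p.1 x < p.1 y) ∧ (∀ x y, p.1 x = y ↔ p.2 y = x)}
  have hX : IsClosed X := by
    have h1 : ∀ x : α, Continuous fun p : (α → α) × (α → α) => p.1 x := fun x =>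
      (continuous_apply x).comp continuous_fst
    have h2 : ∀ x : α, Continuous fun p : (α → α) × (α → α) => p.2 x := fun x =>
      (continuous_apply x).comp continuous_snd
    have key : X = (⋂ x, ⋂ y, {p | x < y → p.1 x < p.1 y}) ∩
        ⋂ x, ⋂ y, {p | p.1 x = y ↔ p.2 y = x} := by
      ext p; simp [X]
    rw [key]
    refine IsClosed.inter ?_ ?_
    · refine isClosed_iInter fun x => isClosed_iInter fun y => ?_
      exact (isClosed_discrete {q : α × α | x < y → q.1 < q.2}).preimage ((h1 x).prodMk (h1 y))
    · refine isClosed_iInter fun x => isClosed_iInter fun y => ?_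
      exact (isClosed_discrete {q : α × α | q.1 = y ↔ q.2 = x}).preimage ((h1 x).prodMk (h2 y))
  have : PolishSpace α := inferInstance
  have : PolishSpace (α → α) := inferInstance
  have : PolishSpace ((α → α) × (α → α)) := inferInstance
  have : PolishSpace X := hX.polishSpace
  let toAut : X → (α ≃o α) := fun p =>
    StrictMono.orderIsoOfSurjective p.1.1 (fun x y h => p.2.1 x y h)
      (fun y => ⟨p.1.2 y, (p.2.2 _ _).2 rfl⟩)
  have htoAut : ∀ p x, toAut p x = p.1.1 x := fun p x => rfl
  have hinj : Function.Injective toAut := by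
    intro p q h
    have h1 : p.1.1 = q.1.1 := funext fun x => by rw [← htoAut, ← htoAut, h]
    refine Subtype.ext (Prod.ext h1 (funext fun y => ?_))
    rw [← p.2.2, h1, q.2.2]
  have : Countable X := hinj.countable
  let ofAut : (α ≃o α) → X := fun g =>
    ⟨(g, g.symm), fun x y h => g.strictMono h, fun x y =>
      ⟨fun h => by simp [← h], fun h => by simp [← h]⟩⟩
  have : Nonempty X := ⟨ofAut 1⟩
  -- The countably many closed singletons cover `X`, so one of them has nonempty interior.
  obtain ⟨p, q, hq⟩ := nonempty_interior_of_iUnion_of_closed (X := X) (f := fun p : X => {p})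
    (fun p => isClosed_singleton) (by ext; simp)
  obtain ⟨U, hU, hUo, hqU⟩ := mem_interior.1 hq
  obtain rfl : q = p := hU hqU
  obtain ⟨V, hVo, rfl⟩ := isOpen_induced_iff.1 hUo
  obtain ⟨V₁, V₂, hV₁, hV₂, hq₁, hq₂, hV⟩ := isOpen_prod_iff.1 hVo q.1.1 q.1.2 hqU
  obtain ⟨I, u, hu, hIu⟩ := isOpen_pi_iff.1 hV₁ _ hq₁
  obtain ⟨J, v, hv, hJv⟩ := isOpen_pi_iff.1 hV₂ _ hq₂
  refine ⟨I ∪ J.image q.1.2, fun g hg => ?_⟩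
  -- If `g` fixes the listed points, `toAut q * g` lies in the neighbourhood `{q}` of `q`.
  have hmem : ofAut (toAut q * g) ∈ ({q} : Set X) := by
    refine hU (hV ⟨hIu fun x hx => ?_, hJv fun y hy => ?_⟩)
    · have : (ofAut (toAut q * g)).1.1 x = q.1.1 x := by
        change toAut q (g x) = _
        rw [hg x (Finset.mem_union_left _ hx)]; rfl
      rw [this]; exact (hu x hx).2
    · have : (ofAut (toAut q * g)).1.2 y = q.1.2 y := by
        rw [← (ofAut (toAut q * g)).2.2]
        change toAut q (g (q.1.2 y)) = _
        rw [hg _ (Finset.mem_union_right _ (Finset.mem_image_of_mem _ hy)), htoAut, q.2.2]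
      rw [this]; exact (hv y hy).2
  have h1 : toAut q * g = toAut q := by
    ext x
    change (ofAut (toAut q * g)).1.1 x = _
    rw [Set.mem_singleton_iff.1 hmem]; rfl
  simpa using h1

/-! ### Decomposition along convex invariant classes -/

section Components

variable {Q : Type*} (c : α → Q)

/-- Restriction of an automorphism to a fibre of a map `c` that it preserves. -/
def restrict (hc : ∀ (g : α ≃o α) x, c (g x) = c x) (g : α ≃o α) (q : Q) :
    {x // c x = q} ≃o {x // c x = q} where
  toFun x := ⟨g x, (hc g x).trans x.2⟩
  invFun x := ⟨g.symm x, (hc g.symm x).trans x.2⟩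
  left_inv x := by simp
  right_inv x := by simp
  map_rel_iff' := by simp

/-- The map obtained by gluing self-maps of the fibres of `c`. -/
def glueFun (k : ∀ q, {x // c x = q} ≃o {x // c x = q}) (x : α) : α := k (c x) ⟨x, rfl⟩

variable {c}

theorem glueFun_eq (k : ∀ q, {x // c x = q} ≃o {x // c x = q}) {x : α} {q : Q} (h : c x = q) :
    glueFun c k x = k q ⟨x, h⟩ := by
  subst h; rfl

theorem apply_glueFun (k : ∀ q, {x // c x = q} ≃o {x // c x = q}) (x : α) :
    c (glueFun c k x) = c x := (k (c x) ⟨x, rfl⟩).2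

theorem strictMono_glueFun (hconv : ∀ x y z, x ≤ y → y ≤ z → c x = c z → c y = c x)
    (k : ∀ q, {x // c x = q} ≃o {x // c x = q}) : StrictMono (glueFun c k) := by
  intro x y hxy
  by_cases h : c x = c y
  · rw [glueFun_eq k h, glueFun_eq k (rfl : c y = c y)]
    exact (k (c y)).strictMono (show (⟨x, h⟩ : {z // c z = c y}) < ⟨y, rfl⟩ from hxy)
  · have hx := apply_glueFun k x
    have hy := apply_glueFun k y
    by_contra! hle
    -- If the images were in the wrong order, one of the two classes would meet the hull
    -- of the other one.
    rcases le_total (glueFun c k y) x with h1 | h1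
    · exact h ((hconv _ _ _ h1 hxy.le hy).trans hy)
    · exact h (hx.symm.trans ((hx ▸ (hconv _ _ _ h1 hle hx.symm).symm).trans hy))

/-- Automorphisms preserving the convex fibres of `c` are the same as families of automorphisms
of the fibres. -/
def equivPi (hc : ∀ (g : α ≃o α) x, c (g x) = c x)
    (hconv : ∀ x y z, x ≤ y → y ≤ z → c x = c z → c y = c x) :
    (α ≃o α) ≃* ∀ q, {x // c x = q} ≃o {x // c x = q} where
  toFun := restrict c hc
  invFun k :=
    { toFun := glueFun c k
      invFun := glueFun c fun q => (k q).symm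
      left_inv := fun x => by
        rw [glueFun_eq _ (apply_glueFun k x)]
        exact congrArg Subtype.val ((k (c x)).symm_apply_apply ⟨x, rfl⟩)
      right_inv := fun x => by
        rw [glueFun_eq _ (apply_glueFun (fun q => (k q).symm) x)]
        exact congrArg Subtype.val ((k (c x)).apply_symm_apply ⟨x, rfl⟩)
      map_rel_iff' := (strictMono_glueFun hconv k).le_iff_le }
  left_inv g := by ext x; rfl
  right_inv k := by
    funext q; ext x
    exact glueFun_eq k x.2
  map_mul' g h := rfl

end Components

variable (α) in
/-- Two points are equivalent if each lies in the convex hull of the orbit of the other one. -/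
def hullSetoid : Setoid α where
  r a b := ∃ g h : α ≃o α, g a ≤ b ∧ b ≤ h a
  iseqv :=
    { refl := fun a => ⟨1, 1, le_rfl, le_rfl⟩
      symm := by
        rintro a b ⟨g, h, hg, hh⟩
        exact ⟨h.symm, g.symm, h.symm_apply_le.2 hh, g.le_symm_apply.2 hg⟩
      trans := by
        rintro a b d ⟨g, h, hg, hh⟩ ⟨g', h', hg', hh'⟩
        exact ⟨g' * g, h' * h, (g'.monotone hg).trans hg', hh'.trans (h'.monotone hh)⟩ }

/-- The class of a point modulo `hullSetoid`. -/
def hull (x : α) : Quotient (hullSetoid α) := Quotient.mk _ x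

theorem hull_eq {x y : α} : hull x = hull y ↔ ∃ g h : α ≃o α, g x ≤ y ∧ y ≤ h x :=
  Quotient.eq (r := hullSetoid α)

theorem hull_apply (g : α ≃o α) (x : α) : hull (g x) = hull x :=
  (hull_eq.2 ⟨g, g, le_rfl, le_rfl⟩).symm

theorem hull_convex (x y z : α) (hxy : x ≤ y) (hyz : y ≤ z) (h : hull x = hull z) :
    hull y = hull x := by
  obtain ⟨_, k, _, hk⟩ := hull_eq.1 h
  exact (hull_eq.2 ⟨1, k, hxy, hyz.trans hk⟩).symm

variable (α) in
/-- The automorphism group is the product of the automorphism groups of the hull classes. -/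
def hullEquivPi : (α ≃o α) ≃* ∀ q, {x : α // hull x = q} ≃o {x : α // hull x = q} :=
  equivPi hull_apply hull_convex

/-- The orbits of a hull class under its own automorphism group are cofinal. -/
theorem exists_le_apply_hull (q : Quotient (hullSetoid α)) (x y : {x : α // hull x = q}) :
    ∃ g : {x : α // hull x = q} ≃o {x : α // hull x = q}, y ≤ g x := by
  obtain ⟨_, h, _, hh⟩ := hull_eq.1 (x.2.trans y.2.symm)
  exact ⟨hullEquivPi α h q, hh⟩

/-! ### Surgery on automorphisms -/

theorem one_apply_mem (D : Set α) (x : α) : (1 : α ≃o α) x ∈ D ↔ x ∈ D := Iff.rfl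

/-- The automorphism equal to `g` on the lower set `D` and to `h` on its complement, where both
`g` and `h` preserve `D`. -/
noncomputable def splice (g h : α ≃o α) (D : Set α) (hD : IsLowerSet D)
    (hg : ∀ x, g x ∈ D ↔ x ∈ D) (hh : ∀ x, h x ∈ D ↔ x ∈ D) : α ≃o α := by
  classical
  refine StrictMono.orderIsoOfSurjective (fun x => if x ∈ D then g x else h x) ?_ ?_
  · intro x y hxy
    by_cases hy : y ∈ D
    · simpa [hy, hD hxy.le hy] using hxy
    · by_cases hx : x ∈ D
      · simp only [hx, hy, if_true, if_false]
        by_contra! hle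
        exact hy ((hh y).1 (hD hle ((hg x).2 hx)))
      · simpa [hx, hy] using hxy
  · intro y
    by_cases hy : y ∈ D
    · have : g.symm y ∈ D := by rw [← hg]; simpa
      exact ⟨g.symm y, by simp [this]⟩
    · have : h.symm y ∉ D := by rw [← hh]; simpa
      exact ⟨h.symm y, by simp [this]⟩

theorem splice_of_mem {g h : α ≃o α} {D : Set α} {hD : IsLowerSet D}
    {hg : ∀ x, g x ∈ D ↔ x ∈ D} {hh : ∀ x, h x ∈ D ↔ x ∈ D} {x : α} (hx : x ∈ D) :
    splice g h D hD hg hh x = g x := if_pos hx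

theorem splice_of_notMem {g h : α ≃o α} {D : Set α} {hD : IsLowerSet D}
    {hg : ∀ x, g x ∈ D ↔ x ∈ D} {hh : ∀ x, h x ∈ D ↔ x ∈ D} {x : α} (hx : x ∉ D) :
    splice g h D hD hg hh x = h x := if_neg hx

/-- The pointwise maximum of an automorphism and the identity. -/
noncomputable def supOne (g : α ≃o α) : α ≃o α :=
  StrictMono.orderIsoOfSurjective (fun x => max (g x) x)
    (fun _ _ h => max_lt_max (g.strictMono h) h)
    (fun y => by
      rcases le_total (g y) y with h | h
      · exact ⟨y, max_eq_right h⟩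
      · refine ⟨g.symm y, ?_⟩
        have : g.symm y ≤ y := g.symm_apply_le.2 h
        simp [this])

theorem supOne_apply (g : α ≃o α) (x : α) : supOne g x = max (g x) x := rfl

/-! ### Freeness of the action on a hull class -/

theorem exists_apply_le (hT : ∀ x y : α, ∃ g : α ≃o α, y ≤ g x) (x y : α) :
    ∃ g : α ≃o α, g x ≤ y := by
  obtain ⟨g, hg⟩ := hT y x
  exact ⟨g.symm, g.symm_apply_le.2 hg⟩

/-- If a finite set has trivial stabilizer, an automorphism supported above a point is trivial:
a conjugate of it is supported above the finite set. -/
theorem eq_one_of_fixes_Iic (hT : ∀ x y : α, ∃ g : α ≃o α, y ≤ g x) {F : Finset α}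
    (hF : ∀ g : α ≃o α, (∀ x ∈ F, g x = x) → g = 1) {u : α ≃o α} {x : α}
    (hu : ∀ z ≤ x, u z = z) : u = 1 := by
  obtain ⟨h, hh⟩ : ∃ h : α ≃o α, ∀ y ∈ F, y ≤ h x := by
    rcases F.eq_empty_or_nonempty with rfl | hne
    · exact ⟨1, by simp⟩
    · obtain ⟨h, hh⟩ := hT x (F.max' hne)
      exact ⟨h, fun y hy => (F.le_max' y hy).trans hh⟩
  have := hF (h * u * h⁻¹) fun y hy => by
    have h1 : h⁻¹ y ≤ x := h.symm_apply_le.2 (hh y hy)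
    rw [RelIso.mul_apply, RelIso.mul_apply, hu _ h1, RelIso.apply_inv_self]
  exact conj_eq_one_iff.1 this

theorem eq_one_of_fixes_Ici (hT : ∀ x y : α, ∃ g : α ≃o α, y ≤ g x) {F : Finset α}
    (hF : ∀ g : α ≃o α, (∀ x ∈ F, g x = x) → g = 1) {u : α ≃o α} {x : α}
    (hu : ∀ z, x ≤ z → u z = z) : u = 1 := by
  obtain ⟨h, hh⟩ : ∃ h : α ≃o α, ∀ y ∈ F, h x ≤ y := by
    rcases F.eq_empty_or_nonempty with rfl | hne
    · exact ⟨1, by simp⟩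
    · obtain ⟨h, hh⟩ := exists_apply_le hT x (F.min' hne)
      exact ⟨h, fun y hy => hh.trans (F.min'_le y hy)⟩
  have := hF (h * u * h⁻¹) fun y hy => by
    have h1 : x ≤ h⁻¹ y := h.le_symm_apply.2 (hh y hy)
    rw [RelIso.mul_apply, RelIso.mul_apply, hu _ h1, RelIso.apply_inv_self]
  exact conj_eq_one_iff.1 this

/-- An automorphism with a fixed point is the product of one supported below that point and
one supported above it, and both are trivial. -/
theorem eq_one_of_apply_eq (hT : ∀ x y : α, ∃ g : α ≃o α, y ≤ g x) {F : Finset α}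
    (hF : ∀ g : α ≃o α, (∀ x ∈ F, g x = x) → g = 1) {g : α ≃o α} {x : α} (hx : g x = x) :
    g = 1 := by
  have hg : ∀ z, g z ∈ Set.Iic x ↔ z ∈ Set.Iic x := fun z => by
    rw [Set.mem_Iic, Set.mem_Iic]; nth_rw 1 [← hx]; exact g.le_iff_le
  have hup : splice 1 g (Set.Iic x) (isLowerSet_Iic x) (one_apply_mem _) hg = 1 :=
    eq_one_of_fixes_Iic hT hF (x := x) fun z hz => splice_of_mem hz
  have hdown : splice g 1 (Set.Iic x) (isLowerSet_Iic x) hg (one_apply_mem _) = 1 :=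
    eq_one_of_fixes_Ici hT hF (x := x) fun z hz => by
      rcases hz.eq_or_lt with rfl | hz
      · rw [splice_of_mem (D := Set.Iic x) (Set.mem_Iic.2 le_rfl), hx]
      · exact splice_of_notMem (Set.notMem_Iic.2 hz)
  ext z
  by_cases hz : z ∈ Set.Iic x
  · rw [← hdown, splice_of_mem hz]
  · rw [← hup, splice_of_notMem hz]

/-! ### The group of a free action is ordered and Archimedean -/

/-- An automorphism is positive if it moves every point up. -/
def Pos (g : α ≃o α) : Prop := ∀ x, x < g x

variable {g h t : α ≃o α}

theorem Pos.conj (hg : Pos g) (k : α ≃o α) : Pos (k * g * k⁻¹) := fun x => by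
  have := k.strictMono (hg (k⁻¹ x))
  rwa [RelIso.apply_inv_self] at this

theorem pos_inv_mul (hgt : ∀ x, g x < t x) : Pos (g⁻¹ * t) := fun x =>
  (OrderIso.lt_symm_apply g).2 (hgt x)

theorem Pos.lt_of_inv_mul (h : Pos (g⁻¹ * t)) (x : α) : g x < t x :=
  (OrderIso.lt_symm_apply g).1 (h x)

/-- Otherwise the maximum of `g` and `1` would be a nontrivial automorphism with a fixed point. -/
theorem pos_of_lt (hfree : ∀ (g : α ≃o α) (x : α), g x = x → g = 1) {x : α} (hx : x < g x) :
    Pos g := by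
  intro y
  by_contra! hy
  have h1 := hfree (supOne g) y (by rw [supOne_apply, max_eq_right hy])
  have h2 : supOne g x = x := by rw [h1]; rfl
  rw [supOne_apply, max_eq_left hx.le] at h2
  exact hx.ne' h2

theorem lt_of_lt (hfree : ∀ (g : α ≃o α) (x : α), g x = x → g = 1) {x : α} (hx : g x < h x)
    (y : α) : g y < h y :=
  (pos_of_lt hfree (g := g⁻¹ * h) ((OrderIso.lt_symm_apply g).2 hx)).lt_of_inv_mul y

theorem trichotomy (hfree : ∀ (g : α ≃o α) (x : α), g x = x → g = 1) [Nonempty α] (g h : α ≃o α) :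
    (∀ x, g x < h x) ∨ g = h ∨ ∀ x, h x < g x := by
  obtain ⟨x⟩ := ‹Nonempty α›
  rcases lt_trichotomy (g x) (h x) with hx | hx | hx
  · exact Or.inl (lt_of_lt hfree hx)
  · refine Or.inr (Or.inl ?_)
    have := hfree (h⁻¹ * g) x (by rw [RelIso.mul_apply, hx, RelIso.inv_apply_self])
    exact (inv_mul_eq_one.1 this).symm
  · exact Or.inr (Or.inr (lt_of_lt hfree hx))

/-- If the powers of `g` are bounded on `x` by `y`, replacing `g` by the identity above the orbit
of `x` gives a nontrivial automorphism fixing `y`. -/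
theorem Pos.exists_lt_pow (hfree : ∀ (g : α ≃o α) (x : α), g x = x → g = 1) (hg : Pos g)
    (x y : α) : ∃ n : ℕ, y < (g ^ n) x := by
  by_contra! hle
  let D : Set α := {z | ∃ n : ℕ, z ≤ (g ^ n) x}
  have hgD : ∀ z, g z ∈ D ↔ z ∈ D := by
    refine fun z => ⟨?_, ?_⟩
    · rintro ⟨n, hn⟩
      exact ⟨n, (hg z).le.trans hn⟩
    · rintro ⟨n, hn⟩
      refine ⟨n + 1, ?_⟩
      rw [pow_succ', RelIso.mul_apply]
      exact g.monotone hn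
  have hy : y ∉ D := by
    rintro ⟨n, hn⟩
    have h1 := hle (n + 1)
    rw [pow_succ', RelIso.mul_apply] at h1
    exact ((hg _).trans_le h1).not_ge hn
  have hD : IsLowerSet D := fun a b hba ⟨n, hn⟩ => ⟨n, hba.trans hn⟩
  have h1 := hfree (splice g 1 D hD hgD
    (one_apply_mem _)) y (splice_of_notMem hy)
  have hx : x ∈ D := ⟨0, le_rfl⟩
  have h2 := splice_of_mem (g := g) (h := 1) (hD := hD)
    (hg := hgD) (hh := one_apply_mem _) hx
  rw [h1] at h2
  exact (hg x).ne h2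

theorem Pos.strictMono_zpow (hg : Pos g) (x : α) : StrictMono fun n : ℤ => (g ^ n) x := by
  refine strictMono_int_of_lt_succ fun n => ?_
  rw [add_comm, zpow_add, zpow_one, RelIso.mul_apply]
  exact hg _

theorem Pos.exists_zpow_le_lt (hfree : ∀ (g : α ≃o α) (x : α), g x = x → g = 1) (hg : Pos g)
    (x y : α) : ∃ n : ℤ, (g ^ n) x ≤ y ∧ y < (g ^ (n + 1)) x := by
  obtain ⟨m, hm⟩ := hg.exists_lt_pow hfree x y
  obtain ⟨l, hl⟩ := hg.exists_lt_pow hfree y x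
  have hbdd : ∀ n : ℤ, (g ^ n) x ≤ y → n ≤ m := fun n hn => by
    by_contra! h
    have := hg.strictMono_zpow x h
    simp only [zpow_natCast] at this
    exact ((this.trans_le hn).trans hm).false
  have hne : (g ^ (-(l : ℤ))) x ≤ y := by
    rw [zpow_neg, zpow_natCast]
    exact (OrderIso.symm_apply_le (g ^ l)).2 hl.le
  obtain ⟨n, hn, hmax⟩ := Int.exists_greatest_of_bdd (P := fun n : ℤ => (g ^ n) x ≤ y)
    ⟨m, hbdd⟩ ⟨_, hne⟩
  refine ⟨n, hn, ?_⟩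
  by_contra! h
  have := hmax _ h
  omega

/-- A free action with a least positive element is cyclic. -/
theorem exists_zpow_eq (hfree : ∀ (g : α ≃o α) (x : α), g x = x → g = 1) [Nonempty α]
    (ht : Pos t) (hmin : ∀ g : α ≃o α, Pos g → ¬ Pos (g⁻¹ * t)) (g : α ≃o α) :
    ∃ n : ℤ, t ^ n = g := by
  obtain ⟨x⟩ := ‹Nonempty α›
  obtain ⟨n, hn, hn'⟩ := ht.exists_zpow_le_lt hfree x (g x)
  refine ⟨n, ?_⟩
  rcases hn.eq_or_lt with h | h
  · have := hfree ((t ^ n)⁻¹ * g) x (by rw [RelIso.mul_apply, ← h, RelIso.inv_apply_self])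
    exact inv_mul_eq_one.1 this
  · have h1 : Pos ((t ^ n)⁻¹ * g) := pos_inv_mul (lt_of_lt hfree h)
    refine absurd ?_ (hmin _ h1)
    have h2 : ((t ^ n)⁻¹ * g)⁻¹ * t = g⁻¹ * t ^ (n + 1) := by
      rw [zpow_add, zpow_one]; group
    rw [h2]
    exact pos_inv_mul (lt_of_lt hfree hn')

/-! ### Back and forth -/

/-- If finite partial relations whose pairs are mutually `R`-compatible can be extended in both
directions, any such relation extends to a compatible relation that is total on both sides. -/
theorem exists_total_compatible {β : Type*} [Countable β] (R : β × β → β × β → Prop)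
    (hsymm : ∀ p q, R p q → R q p)
    (hforth : ∀ P : Finset (β × β), (∀ p ∈ P, ∀ q ∈ P, R p q) → ∀ x, ∃ y,
      R (x, y) (x, y) ∧ ∀ p ∈ P, R p (x, y))
    (hback : ∀ P : Finset (β × β), (∀ p ∈ P, ∀ q ∈ P, R p q) → ∀ y, ∃ x,
      R (x, y) (x, y) ∧ ∀ p ∈ P, R p (x, y))
    (P₀ : Finset (β × β)) (hP₀ : ∀ p ∈ P₀, ∀ q ∈ P₀, R p q) :
    ∃ S : Set (β × β), (∀ p ∈ P₀, p ∈ S) ∧ (∀ p ∈ S, ∀ q ∈ S, R p q) ∧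
      (∀ x, ∃ y, (x, y) ∈ S) ∧ ∀ y, ∃ x, (x, y) ∈ S := by
  classical
  have _ : Encodable β := Encodable.ofCountable β
  let Part := {P : Finset (β × β) // ∀ p ∈ P, ∀ q ∈ P, R p q}
  have insert_mem : ∀ (P : Part) (a : β × β), R a a → (∀ p ∈ P.1, R p a) →
      ∀ p ∈ insert a P.1, ∀ q ∈ insert a P.1, R p q := by
    intro P a haa ha p hp q hq
    rcases Finset.mem_insert.1 hp with rfl | hp' <;> rcases Finset.mem_insert.1 hq with rfl | hq'
    · exact haa
    · exact hsymm _ _ (ha q hq')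
    · exact ha p hp'
    · exact P.2 p hp' q hq'
  -- The cofinal sets say that a given point is in the domain (`inl`) or in the range (`inr`).
  let D : β ⊕ β → Order.Cofinal Part := Sum.elim
    (fun x =>
      { carrier := {P | ∃ y, (x, y) ∈ P.1}
        isCofinal := fun P => by
          obtain ⟨y, hy, hP⟩ := hforth P.1 P.2 x
          exact ⟨⟨insert (x, y) P.1, insert_mem P _ hy hP⟩, ⟨y, Finset.mem_insert_self _ _⟩,
            Finset.subset_insert _ _⟩ })
    (fun y =>
      { carrier := {P | ∃ x, (x, y) ∈ P.1}
        isCofinal := fun P => by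
          obtain ⟨x, hx, hP⟩ := hback P.1 P.2 y
          exact ⟨⟨insert (x, y) P.1, insert_mem P _ hx hP⟩, ⟨x, Finset.mem_insert_self _ _⟩,
            Finset.subset_insert _ _⟩ })
  let I := Order.idealOfCofinals (⟨P₀, hP₀⟩ : Part) D
  refine ⟨{p | ∃ P ∈ I, p ∈ P.1}, fun p hp => ⟨_, Order.mem_idealOfCofinals _ D, hp⟩, ?_, ?_, ?_⟩
  · rintro p ⟨P, hP, hpP⟩ q ⟨P', hP', hqP'⟩
    obtain ⟨T, -, hT, hT'⟩ := I.directed _ hP _ hP'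
    exact T.2 p (hT hpP) q (hT' hqP')
  · intro x
    obtain ⟨P, ⟨y, hy⟩, hP⟩ := Order.cofinal_meets_idealOfCofinals (⟨P₀, hP₀⟩ : Part) D (Sum.inl x)
    exact ⟨y, P, hP, hy⟩
  · intro y
    obtain ⟨P, ⟨x, hx⟩, hP⟩ := Order.cofinal_meets_idealOfCofinals (⟨P₀, hP₀⟩ : Part) D (Sum.inr y)
    exact ⟨x, P, hP, hx⟩

variable {x y z : α}

/-- `x` is far below `y` if some positive automorphism still maps `x` below `y`. When the positive
automorphisms have no least element, the points of a hull class have positions on a densely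
ordered line, and this relation says that the position of `x` is smaller than that of `y`. -/
def Far (x y : α) : Prop := ∃ g : α ≃o α, Pos g ∧ g x ≤ y

theorem Pos.far {t : α ≃o α} (ht : Pos t) (x : α) : Far x (t x) := ⟨t, ht, le_rfl⟩

theorem Far.lt (h : Far x y) : x < y := by
  obtain ⟨g, hg, hgx⟩ := h
  exact (hg x).trans_le hgx

theorem Far.trans_le (h : Far x y) (hyz : y ≤ z) : Far x z := by
  obtain ⟨g, hg, hgx⟩ := h
  exact ⟨g, hg, hgx.trans hyz⟩

theorem Far.of_le (hxy : x ≤ y) (h : Far y z) : Far x z := by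
  obtain ⟨g, hg, hgx⟩ := h
  exact ⟨g, hg, (g.monotone hxy).trans hgx⟩

theorem Far.not_far (h : Far x y) : ¬ Far y x := fun h' => h.lt.asymm h'.lt

theorem Far.map (h : Far x y) (k : α ≃o α) : Far (k x) (k y) := by
  obtain ⟨g, hg, hgx⟩ := h
  refine ⟨k * g * k⁻¹, hg.conj k, ?_⟩
  rw [RelIso.mul_apply, RelIso.inv_apply_self]
  exact k.monotone hgx

theorem far_map_iff (k : α ≃o α) : Far (k x) (k y) ↔ Far x y :=
  ⟨fun h => by simpa only [RelIso.inv_apply_self] using h.map k⁻¹, fun h => h.map k⟩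

/-- Two pairs are compatible if their first components and their second components have the same
relative position, and, when the positions agree, a single automorphism realizes both pairs. -/
def Compatible (p q : α × α) : Prop :=
  (Far p.1 q.1 ↔ Far p.2 q.2) ∧ (Far q.1 p.1 ↔ Far q.2 p.2) ∧
    (¬ Far p.1 q.1 → ¬ Far q.1 p.1 → ∃ g : α ≃o α, g p.1 = p.2 ∧ g q.1 = q.2)

theorem Compatible.symm {p q : α × α} (h : Compatible p q) : Compatible q p := by
  refine ⟨h.2.1, h.1, fun h1 h2 => ?_⟩
  obtain ⟨g, hp, hq⟩ := h.2.2 h2 h1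
  exact ⟨g, hq, hp⟩

theorem Compatible.swap {p q : α × α} (h : Compatible p q) : Compatible p.swap q.swap := by
  refine ⟨h.1.symm, h.2.1.symm, fun h1 h2 => ?_⟩
  obtain ⟨g, hp, hq⟩ := h.2.2 (mt h.1.1 h1) (mt h.2.1.1 h2)
  refine ⟨g⁻¹, ?_, ?_⟩
  · simp only [Prod.fst_swap, Prod.snd_swap, ← hp, RelIso.inv_apply_self]
  · simp only [Prod.fst_swap, Prod.snd_swap, ← hq, RelIso.inv_apply_self]

theorem compatible_of_apply (g : α ≃o α) (x y : α) : Compatible (x, g x) (y, g y) :=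
  ⟨(far_map_iff g).symm, (far_map_iff g).symm, fun _ _ => ⟨g, rfl, rfl⟩⟩

theorem compatible_of_far {p q : α × α} (h₁ : Far p.1 q.1) (h₂ : Far p.2 q.2) :
    Compatible p q :=
  ⟨iff_of_true h₁ h₂, iff_of_false h₁.not_far h₂.not_far, fun h => absurd h₁ h⟩

/-! ### An action without least positive element is not free -/

section Dense

variable [Nonempty α]

/-- In a densely ordered group every positive element is at least a square of a positive one. -/
theorem Pos.exists_half (hfree : ∀ (g : α ≃o α) (x : α), g x = x → g = 1)
    (hdense : ∀ t : α ≃o α, Pos t → ∃ g : α ≃o α, Pos g ∧ Pos (g⁻¹ * t)) {t : α ≃o α}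
    (ht : Pos t) : ∃ e : α ≃o α, Pos e ∧ ∀ x, e (e x) ≤ t x := by
  obtain ⟨k, hk, hm⟩ := hdense t ht
  have hkm : ∀ x, k ((k⁻¹ * t) x) = t x := fun x => by
    rw [RelIso.mul_apply, RelIso.apply_inv_self]
  generalize k⁻¹ * t = m at hm hkm
  rcases trichotomy hfree k m with h | h | h
  · exact ⟨k, hk, fun x => hkm x ▸ k.monotone (h x).le⟩
  · exact ⟨k, hk, fun x => hkm x ▸ k.monotone (h ▸ le_rfl)⟩
  · exact ⟨m, hm, fun x => hkm x ▸ (h (m x)).le⟩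

theorem Far.or (hfree : ∀ (g : α ≃o α) (x : α), g x = x → g = 1)
    (hdense : ∀ t : α ≃o α, Pos t → ∃ g : α ≃o α, Pos g ∧ Pos (g⁻¹ * t))
    (h : Far x z) (y : α) : Far x y ∨ Far y z := by
  obtain ⟨g, hg, hgx⟩ := h
  obtain ⟨e, he, hee⟩ := hg.exists_half hfree hdense
  rcases le_total (e x) y with hy | hy
  · exact Or.inl ⟨e, he, hy⟩
  · exact Or.inr ⟨e, he, (e.monotone hy).trans ((hee x).trans hgx)⟩

theorem far_congr_right (hfree : ∀ (g : α ≃o α) (x : α), g x = x → g = 1)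
    (hdense : ∀ t : α ≃o α, Pos t → ∃ g : α ≃o α, Pos g ∧ Pos (g⁻¹ * t))
    (hxy : ¬ Far x y) (hyx : ¬ Far y x) (z : α) : Far z x ↔ Far z y :=
  ⟨fun h => (h.or hfree hdense y).resolve_right hyx,
    fun h => (h.or hfree hdense x).resolve_right hxy⟩

theorem far_congr_left (hfree : ∀ (g : α ≃o α) (x : α), g x = x → g = 1)
    (hdense : ∀ t : α ≃o α, Pos t → ∃ g : α ≃o α, Pos g ∧ Pos (g⁻¹ * t))
    (hxy : ¬ Far x y) (hyx : ¬ Far y x) (z : α) : Far x z ↔ Far y z :=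
  ⟨fun h => (h.or hfree hdense y).resolve_left hxy,
    fun h => (h.or hfree hdense x).resolve_left hyx⟩

/-- Every orbit is dense: with `d` positive and `d ^ 4` at most the gap between `x` and `y`, the
first power of `d` that moves `c` above `d x` moves it into the gap. -/
theorem Far.exists_between (hfree : ∀ (g : α ≃o α) (x : α), g x = x → g = 1)
    (hdense : ∀ t : α ≃o α, Pos t → ∃ g : α ≃o α, Pos g ∧ Pos (g⁻¹ * t))
    (h : Far x y) (c : α) : ∃ k : α ≃o α, Far x (k c) ∧ Far (k c) y := by
  obtain ⟨t, ht, htx⟩ := h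
  obtain ⟨e, he, hee⟩ := ht.exists_half hfree hdense
  obtain ⟨d, hd, hdd⟩ := he.exists_half hfree hdense
  obtain ⟨n, hn, hn'⟩ := hd.exists_zpow_le_lt hfree c (d x)
  refine ⟨d ^ (n + 1), ⟨d, hd, hn'.le⟩, d, hd, ?_⟩
  rw [add_comm, zpow_add, zpow_one, RelIso.mul_apply]
  calc d (d ((d ^ n) c)) ≤ d (d (d x)) := d.monotone (d.monotone hn)
    _ ≤ d (d (d (d x))) := d.monotone (d.monotone (hd _).le)
    _ ≤ e (d (d x)) := hdd _
    _ ≤ e (e x) := e.monotone (hdd x)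
    _ ≤ t x := hee x
    _ ≤ y := htx

theorem exists_far_between_finsets (hfree : ∀ (g : α ≃o α) (x : α), g x = x → g = 1)
    (hdense : ∀ t : α ≃o α, Pos t → ∃ g : α ≃o α, Pos g ∧ Pos (g⁻¹ * t))
    {t : α ≃o α} (ht : Pos t) (L U : Finset α) (hLU : ∀ l ∈ L, ∀ u ∈ U, Far l u) (c : α) :
    ∃ g : α ≃o α, (∀ l ∈ L, Far l (g c)) ∧ ∀ u ∈ U, Far (g c) u := by
  have ht' : ∀ u, Far (t⁻¹ u) u := fun u => by
    simpa only [RelIso.apply_inv_self] using ht.far (t⁻¹ u)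
  obtain ⟨l, u, hlu, hl, hu⟩ : ∃ l u, Far l u ∧ (∀ a ∈ L, a ≤ l) ∧ ∀ b ∈ U, u ≤ b := by
    rcases L.eq_empty_or_nonempty with rfl | hL <;> rcases U.eq_empty_or_nonempty with rfl | hU
    · exact ⟨c, t c, ht.far c, by simp, by simp⟩
    · exact ⟨_, U.min' hU, ht' _, by simp, fun b hb => U.min'_le b hb⟩
    · exact ⟨L.max' hL, _, ht.far _, fun a ha => L.le_max' a ha, by simp⟩
    · exact ⟨L.max' hL, U.min' hU, hLU _ (L.max'_mem hL) _ (U.min'_mem hU),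
        fun a ha => L.le_max' a ha, fun b hb => U.min'_le b hb⟩
  obtain ⟨g, hg, hg'⟩ := hlu.exists_between hfree hdense c
  exact ⟨g, fun a ha => Far.of_le (hl a ha) hg, fun b hb => hg'.trans_le (hu b hb)⟩

/-- The extension step: either the position of `x` is already taken, and the automorphism is the
one used there, or it lies in a cut of finitely many positions, and the orbit of `x` meets the
corresponding cut on the other side. -/
theorem exists_compatible_extension (hfree : ∀ (g : α ≃o α) (x : α), g x = x → g = 1)
    (hdense : ∀ t : α ≃o α, Pos t → ∃ g : α ≃o α, Pos g ∧ Pos (g⁻¹ * t))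
    {t : α ≃o α} (ht : Pos t) (P : Finset (α × α)) (hP : ∀ p ∈ P, ∀ q ∈ P, Compatible p q)
    (x : α) : ∃ g : α ≃o α, ∀ p ∈ P, Compatible p (x, g x) := by
  classical
  by_cases hx : ∃ p ∈ P, ¬ Far p.1 x ∧ ¬ Far x p.1
  · obtain ⟨p, hp, h1, h2⟩ := hx
    obtain ⟨g, hg, -⟩ := (hP p hp p hp).2.2 (fun h => h.lt.false) (fun h => h.lt.false)
    have h1' : ¬ Far p.2 (g x) := by rwa [← hg, far_map_iff]
    have h2' : ¬ Far (g x) p.2 := by rwa [← hg, far_map_iff]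
    refine ⟨g, fun q hq => ?_⟩
    have hqp := hP q hq p hp
    have hR := far_congr_right hfree hdense h1 h2 q.1
    have hL := far_congr_left hfree hdense h1 h2 q.1
    refine ⟨?_, ?_, fun hq1 hq2 => ?_⟩
    · exact hR.symm.trans (hqp.1.trans (far_congr_right hfree hdense h1' h2' q.2))
    · exact hL.symm.trans (hqp.2.1.trans (far_congr_left hfree hdense h1' h2' q.2))
    · obtain ⟨k, hkq, hkp⟩ := hqp.2.2 (mt hR.1 hq1) (mt hL.1 hq2)
      have hkg : g⁻¹ * k = 1 := hfree _ p.1 (by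
        rw [RelIso.mul_apply, hkp, ← hg, RelIso.inv_apply_self])
      obtain rfl : g = k := inv_mul_eq_one.1 hkg
      exact ⟨g, hkq, rfl⟩
  · push Not at hx
    obtain ⟨g, hg, hg'⟩ := exists_far_between_finsets hfree hdense ht
      ((P.filter fun p => Far p.1 x).image Prod.snd) ((P.filter fun p => Far x p.1).image Prod.snd)
      (by
        intro l hl u hu
        obtain ⟨p, hp, rfl⟩ := Finset.mem_image.1 hl
        obtain ⟨q, hq, rfl⟩ := Finset.mem_image.1 hu
        rw [Finset.mem_filter] at hp hq
        exact (hP p hp.1 q hq.1).1.1 (hp.2.trans_le hq.2.lt.le)) x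
    refine ⟨g, fun p hp => ?_⟩
    by_cases h : Far p.1 x
    · exact compatible_of_far h
        (hg _ (Finset.mem_image_of_mem _ (Finset.mem_filter.2 ⟨hp, h⟩)))
    · have h' := hx p hp h
      exact (compatible_of_far (p := (x, g x)) h'
        (hg' _ (Finset.mem_image_of_mem _ (Finset.mem_filter.2 ⟨hp, h'⟩)))).symm

/-- On a countable order whose positive automorphisms have no least element, the action cannot be
free: starting from `a ↦ a` and `t a ↦ t (t a)`, back and forth yields an automorphism that fixes
`a` and moves `t a`. -/
theorem not_pos_of_dense [Countable α] (hfree : ∀ (g : α ≃o α) (x : α), g x = x → g = 1)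
    (hdense : ∀ t : α ≃o α, Pos t → ∃ g : α ≃o α, Pos g ∧ Pos (g⁻¹ * t))
    (t : α ≃o α) : ¬ Pos t := by
  classical
  intro ht
  obtain ⟨a⟩ := ‹Nonempty α›
  have hforth : ∀ P : Finset (α × α), (∀ p ∈ P, ∀ q ∈ P, Compatible p q) → ∀ x, ∃ y,
      Compatible (x, y) (x, y) ∧ ∀ p ∈ P, Compatible p (x, y) := by
    intro P hP x
    obtain ⟨g, hg⟩ := exists_compatible_extension hfree hdense ht P hP x
    exact ⟨g x, compatible_of_apply g x x, hg⟩
  have hback : ∀ P : Finset (α × α), (∀ p ∈ P, ∀ q ∈ P, Compatible p q) → ∀ y, ∃ x,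
      Compatible (x, y) (x, y) ∧ ∀ p ∈ P, Compatible p (x, y) := by
    intro P hP y
    obtain ⟨x, hx, hPx⟩ := hforth (P.image Prod.swap) (by
      intro p hp q hq
      obtain ⟨p, hp', rfl⟩ := Finset.mem_image.1 hp
      obtain ⟨q, hq', rfl⟩ := Finset.mem_image.1 hq
      exact (hP p hp' q hq').swap) y
    exact ⟨x, hx.swap, fun p hp => by
      simpa using (hPx _ (Finset.mem_image_of_mem _ hp)).swap⟩
  have h₀ : Compatible (a, a) (t a, t (t a)) :=
    compatible_of_far (ht.far a) ((ht.far a).trans_le (ht _).le)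
  obtain ⟨S, hS₀, hS, hS1, hS2⟩ := exists_total_compatible Compatible (fun p q h => h.symm)
    hforth hback {(a, a), (t a, t (t a))} (by
      intro p hp q hq
      simp only [Finset.mem_insert, Finset.mem_singleton] at hp hq
      rcases hp with rfl | rfl <;> rcases hq with rfl | rfl
      · exact compatible_of_apply 1 a a
      · exact h₀
      · exact h₀.symm
      · exact compatible_of_apply t _ _)
  have hmono : ∀ p ∈ S, ∀ q ∈ S, p.1 < q.1 → p.2 < q.2 := by
    intro p hp q hq hpq
    obtain ⟨h1, -, h3⟩ := hS p hp q hq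
    by_cases h : Far p.1 q.1
    · exact (h1.1 h).lt
    · obtain ⟨g, hgp, hgq⟩ := h3 h fun h' => hpq.asymm h'.lt
      rw [← hgp, ← hgq]
      exact g.strictMono hpq
  have hfun : ∀ p ∈ S, ∀ q ∈ S, p.1 = q.1 → p.2 = q.2 := by
    intro p hp q hq hpq
    obtain ⟨g, hgp, hgq⟩ := (hS p hp q hq).2.2 (fun h => h.lt.ne hpq) (fun h => h.lt.ne' hpq)
    rw [← hgp, ← hgq, hpq]
  choose f hf using hS1
  have hfS : ∀ p ∈ S, f p.1 = p.2 := fun p hp => hfun _ (hf p.1) p hp rfl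
  let φ : α ≃o α := StrictMono.orderIsoOfSurjective f
    (fun x y hxy => hmono _ (hf x) _ (hf y) hxy)
    (fun y => by
      obtain ⟨x, hx⟩ := hS2 y
      exact ⟨x, hfS _ hx⟩)
  have hφ : φ = 1 := hfree φ a (hfS (a, a) (hS₀ _ (by simp)))
  have h1 : φ (t a) = t (t a) := hfS (t a, t (t a)) (hS₀ _ (by simp))
  rw [hφ] at h1
  exact (ht (t a)).ne h1

end Dense

/-- A countable order on which the automorphism group acts freely has a trivial or infinite cyclic
automorphism group. -/
theorem subsingleton_or_nonempty_mulEquiv_int [Countable α] [Nonempty α]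
    (hfree : ∀ (g : α ≃o α) (x : α), g x = x → g = 1) :
    Subsingleton (α ≃o α) ∨ Nonempty (Multiplicative ℤ ≃* (α ≃o α)) := by
  by_cases h : ∃ t : α ≃o α, Pos t ∧ ∀ g : α ≃o α, Pos g → ¬ Pos (g⁻¹ * t)
  · obtain ⟨t, ht, hmin⟩ := h
    refine Or.inr ⟨MulEquiv.ofBijective (zpowersHom _ t) ⟨fun m n hmn => ?_, fun g => ?_⟩⟩
    · obtain ⟨x⟩ := ‹Nonempty α›
      simp only [zpowersHom_apply] at hmn
      exact Multiplicative.toAdd.injective ((ht.strictMono_zpow x).injective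
        (by simp only [hmn]))
    · obtain ⟨n, hn⟩ := exists_zpow_eq hfree ht hmin g
      exact ⟨Multiplicative.ofAdd n, by simpa using hn⟩
  · push Not at h
    have hnot := not_pos_of_dense hfree h
    refine Or.inl ⟨fun g k => ?_⟩
    rcases trichotomy hfree g k with h1 | h1 | h1
    · exact absurd (pos_inv_mul h1) (hnot _)
    · exact h1
    · exact absurd (pos_inv_mul h1) (hnot _)

/-! ### The product of the classes -/

/-- In a countable order with countable automorphism group, the automorphism group of each hull
class is trivial or infinite cyclic. -/
theorem subsingleton_or_nonempty_mulEquiv_int_hull [Countable α] [Countable (α ≃o α)]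
    (q : Quotient (hullSetoid α)) :
    Subsingleton ({x : α // hull x = q} ≃o {x : α // hull x = q}) ∨
      Nonempty (Multiplicative ℤ ≃* ({x : α // hull x = q} ≃o {x : α // hull x = q})) := by
  classical
  have : Countable ({x : α // hull x = q} ≃o {x : α // hull x = q}) :=
    ((hullEquivPi α).symm.injective.comp
      (Pi.mulSingle_injective (M := fun q => {x : α // hull x = q} ≃o {x : α // hull x = q})
        q)).countable
  obtain ⟨F, hF⟩ := exists_finset_stabilizer_eq_one (α := {x : α // hull x = q})
  have : Nonempty {x : α // hull x = q} := by
    obtain ⟨x, hx⟩ := Quotient.exists_rep q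
    exact ⟨⟨x, hx⟩⟩
  exact subsingleton_or_nonempty_mulEquiv_int fun g x hx =>
    eq_one_of_apply_eq (exists_le_apply_hull q) hF hx

/-- Each class with a nontrivial automorphism meets a finite set with trivial stabilizer. -/
theorem finite_nontrivial_hull [Countable α] [Countable (α ≃o α)] :
    Finite {q : Quotient (hullSetoid α) //
      ¬ Subsingleton ({x : α // hull x = q} ≃o {x : α // hull x = q})} := by
  classical
  obtain ⟨F, hF⟩ := exists_finset_stabilizer_eq_one (α := α)
  refine Set.Finite.subset (F.image hull).finite_toSet fun q hq => ?_
  by_contra hqF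
  refine hq ⟨fun g k => ?_⟩
  have key : ∀ g : {x : α // hull x = q} ≃o {x : α // hull x = q}, g = 1 := fun g => by
    have h1 := hF ((hullEquivPi α).symm (Pi.mulSingle q g)) fun x hx => by
      have hne : hull x ≠ q := fun h =>
        hqF (Finset.mem_coe.2 (h ▸ Finset.mem_image_of_mem _ hx))
      change ((Pi.mulSingle q g : ∀ q, {x : α // hull x = q} ≃o {x : α // hull x = q})
        (hull x) ⟨x, rfl⟩ : α) = x
      rw [Pi.mulSingle_eq_of_ne hne]
      rfl
    rw [map_eq_one_iff _ (hullEquivPi α).symm.injective] at h1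
    exact Pi.mulSingle_eq_one_iff.1 h1
  rw [key g, key k]

/-- A product of groups that are trivial or infinite cyclic, finitely many of them nontrivial,
is free abelian of finite rank. -/
theorem nonempty_pi_mulEquiv_freeAbelianGroup {ι : Type*} {A : ι → Type*} [∀ i, Group (A i)]
    (hA : ∀ i, Subsingleton (A i) ∨ Nonempty (Multiplicative ℤ ≃* A i))
    [Finite {i // ¬ Subsingleton (A i)}] :
    ∃ n : ℕ, Nonempty ((∀ i, A i) ≃* Multiplicative (FreeAbelianGroup (Fin n))) := by
  classical
  obtain ⟨n, ⟨e⟩⟩ := Finite.exists_equiv_fin {i // ¬ Subsingleton (A i)}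
  have φ : ∀ i : {i // ¬ Subsingleton (A i)}, Multiplicative ℤ ≃* A i.1 := fun i =>
    Classical.choice ((hA i.1).resolve_left i.2)
  let ψ : (∀ i, A i) →* Multiplicative (Fin n → ℤ) :=
    { toFun := fun f => Multiplicative.ofAdd fun j => ((φ (e.symm j)).symm (f (e.symm j))).toAdd
      map_one' := by
        apply Multiplicative.toAdd.injective; funext j; simp
      map_mul' := fun f f' => by
        apply Multiplicative.toAdd.injective; funext j; simp }
  have hψ : Function.Bijective ψ := by
    constructor
    · intro f f' h
      funext i
      by_cases hi : Subsingleton (A i)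
      · exact Subsingleton.elim _ _
      · have := congrFun (congrArg Multiplicative.toAdd h) (e ⟨i, hi⟩)
        have h2 : f (e.symm (e ⟨i, hi⟩)) = f' (e.symm (e ⟨i, hi⟩)) :=
          (φ _).symm.injective (Multiplicative.toAdd.injective this)
        rwa [e.symm_apply_apply] at h2
    · intro v
      refine ⟨fun i => if hi : Subsingleton (A i) then 1 else
        φ ⟨i, hi⟩ (Multiplicative.ofAdd (v.toAdd (e ⟨i, hi⟩))), ?_⟩
      apply Multiplicative.toAdd.injective
      funext j
      have hj := (e.symm j).2
      simp only [ψ, MonoidHom.coe_mk, OneHom.coe_mk, dif_neg hj, toAdd_ofAdd, Subtype.coe_eta,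
        MulEquiv.symm_apply_apply, Equiv.apply_symm_apply]
  exact ⟨n, ⟨(MulEquiv.ofBijective ψ hψ).trans (AddEquiv.toMultiplicative
    ((FreeAbelianGroup.equivFinsupp (Fin n)).trans
      (Finsupp.linearEquivFunOnFinite ℤ ℤ (Fin n)).toAddEquiv).symm)⟩⟩

end OrderAut

theorem theorem1p4 {Ω : Type*} [LinearOrder Ω] [Countable Ω]
    (hAut : Countable (Ω ≃o Ω)) :
    ∃ n : ℕ, Nonempty ((Ω ≃o Ω) ≃* Multiplicative (FreeAbelianGroup (Fin n))) := by
  have := OrderAut.finite_nontrivial_hull (α := Ω)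
  obtain ⟨n, ⟨φ⟩⟩ := OrderAut.nonempty_pi_mulEquiv_freeAbelianGroup
    (OrderAut.subsingleton_or_nonempty_mulEquiv_int_hull (α := Ω))
  exact ⟨n, ⟨(OrderAut.hullEquivPi Ω).trans φ⟩⟩
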